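/- There is an absolute constant $c>0$ such that the following holds. Let $0\le M_1<M_2<\infty$ and $K>0$. Then there is a constant $C>0$, depending only on $M_1$, $M_2$ and $K$, such that for all integers $n,p\ge 1$ and all $\epsilon\ge 0$ with $\frac pn+\epsilon^2\le K$, $$\inf_{\widehat\Sigma}\ \sup_{\substack{\Sigma^*\in\Theta\\ P:\,W(P_{\Sigma^*},P)\le\epsilon}}\ \mathbb P_{X_1,\dots,X_n\,\overset{i.i.d.}{\sim}\,P}\left(\|\Sigma^*-\widehat\Sigma\|_2\ \ge\ C\left(\sqrt{\tfrac pn}\vee\epsilon\right)\right)\ \ge\ c .$$ Here $\Theta=\{\Sigma\in\mathbb R^{p\times p}:\ \Sigma\succeq 0,\ \lambda_{\min}(\Sigma)\ge M_1,\ \lambda_{\max}(\Sigma)\le M_2\}$; $P_{\Sigma}=\mathcal N(0,\Sigma)$ on $\mathbb R^p$; $P$ ranges over the Borel probability measures on $\mathbb R^p$; $W(\mu,\nu)=\inf_{\pi}\mathbb E_{(X,Y)\sim\pi}\|X-Y\|_2$ is the Wasserstein distance of order one, the infimum being over all couplings $\pi$ of $\mu$ and $\nu$; $\|\cdot\|_2$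 of a matrix is the spectral norm; and $\widehat\Sigma$ ranges over all estimators, i.e. measurable functions $\widehat\Sigma=\widehat\Sigma(X_1,\dots,X_n)$ with values in $\mathbb R^{p\times p}$. -/

import Mathlib

open MeasureTheory ProbabilityTheory

open scoped ENNReal

noncomputable section

namespace RobustCov

/-- `π` is a coupling of `μ` and `ν`: a measure on the product with marginals `μ` and `ν`. -/
def IsCoupling {E : Type*} [MeasurableSpace E] (π : Measure (E × E)) (μ ν : Measure E) : Prop :=
  π.map Prod.fst = μ ∧ π.map Prod.snd = ν

/-- The Wasserstein distance of order one, `inf_π E_{(X,Y) ∼ π} ‖X - Y‖₂` over all couplings `π`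
of `μ` and `ν`, for measures on Euclidean space; it takes values in `[0, ∞]`. -/
def W1 {p : ℕ} (μ ν : Measure (EuclideanSpace ℝ (Fin p))) : ℝ≥0∞ :=
  ⨅ (π : Measure (EuclideanSpace ℝ (Fin p) × EuclideanSpace ℝ (Fin p))) (_ : IsCoupling π μ ν),
    ∫⁻ z, ‖z.1 - z.2‖ₑ ∂π

/-- The spectral norm of a real square matrix: its operator norm for the Euclidean norm. -/
def specNorm {p : ℕ} (A : Matrix (Fin p) (Fin p) ℝ) : ℝ :=
  ‖Matrix.toEuclideanCLM (n := Fin p) (𝕜 := ℝ) A‖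

/-- The parameter space: symmetric positive semidefinite `p × p` matrices all of whose eigenvalues
lie in `[M₁, M₂]`. -/
def covClass (p : ℕ) (M₁ M₂ : ℝ) : Set (Matrix (Fin p) (Fin p) ℝ) :=
  {S | S.PosSemidef ∧ ∀ μ ∈ spectrum ℝ S, M₁ ≤ μ ∧ μ ≤ M₂}

/-- The contaminated distributions: Borel probability measures on `ℝ^p` at Wasserstein distance at
most `ε` from `N(0, S)`. -/
def contaminated {p : ℕ} (S : Matrix (Fin p) (Fin p) ℝ) (ε : ℝ) :
    Set (Measure (EuclideanSpace ℝ (Fin p))) :=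
  {P | IsProbabilityMeasure P ∧ W1 (multivariateGaussian 0 S) P ≤ ENNReal.ofReal ε}

/-- The estimators: functions of `n` observations in `ℝ^p` with values in the `p × p` real
matrices, measurable in each entry. -/
def estimators (n p : ℕ) :
    Set ((Fin n → EuclideanSpace ℝ (Fin p)) → Matrix (Fin p) (Fin p) ℝ) :=
  {T | ∀ i j, Measurable fun X => T X i j}

/-- The minimax probability of a spectral-norm error of at least `r`, that is
`inf_T sup_{S, P} ℙ (‖S - T (X₁, …, Xₙ)‖₂ ≥ r)` with `X₁, …, Xₙ` i.i.d. from `P`, where `T` ranges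
over the estimators, `S` over the parameter space and `P` over the contaminations of `N(0, S)`. -/
def minimaxProb (n p : ℕ) (M₁ M₂ ε r : ℝ) : ℝ≥0∞ :=
  ⨅ T ∈ estimators n p, ⨆ S ∈ covClass p M₁ M₂, ⨆ P ∈ contaminated S ε,
    (Measure.pi fun _ : Fin n => P) {X | r ≤ specNorm (S - T X)}

end RobustCov

end

namespace RobustCov

open scoped RealInnerProductSpace

noncomputable section

/-! The larger of `√(p/n)` and `ε` decides which of two obstructions is used. If `ε` dominates,
shrinking an `N(0, M₂ I)` vector by a factor `1 - a` along one direction costs at most `a E|N(0,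
M₂)|` in transport, whatever `p` is, but changes the covariance by at least `M₂ a`. The unshrunk law
is admissible for both covariances, so no sample distinguishes them
(`half_le_minimaxProb_of_contamination`). If `√(p/n)` dominates, no contamination is needed. The
hypotheses are `m (I ± τ v vᵀ)` over all sign vectors `v`. Each `n`-fold law has second moment at
most `exp (n τ²) ≤ exp (p/16)` relative to `N(0, m I)`, while only a fraction of order `exp (-p/8)`
of the hypotheses can be close to one matrix; an estimator good for all of them would contradict
this (`eighth_le_minimaxProb`). Counting overlaps of acceptance regions replaces a packing argument.
-/

/-- `P` has a square-integrable density with respect to `Q`, with second moment at most `A`,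
expressed through the functional inequality `(∫ f dP)² ≤ A ∫ f² dQ`. -/
def ChiBound {α : Type*} [MeasurableSpace α] (A : ℝ≥0∞) (P Q : Measure α) : Prop :=
  ∀ f : α → ℝ≥0∞, Measurable f → (∫⁻ x, f x ∂P) ^ 2 ≤ A * ∫⁻ x, f x ^ 2 ∂Q

/-! ### Second-moment comparison of measures. -/

section ChiBound

variable {α β : Type*} [MeasurableSpace α] [MeasurableSpace β]

lemma sq_lintegral_mul_le (μ : Measure α) {f g : α → ℝ≥0∞} (hf : Measurable f)
    (hg : Measurable g) :
    (∫⁻ x, f x * g x ∂μ) ^ 2 ≤ (∫⁻ x, g x ^ 2 ∂μ) * ∫⁻ x, f x ^ 2 ∂μ := by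
  have h := ENNReal.lintegral_mul_le_Lp_mul_Lq μ (p := 2) (q := 2)
    (by constructor <;> norm_num) hf.aemeasurable hg.aemeasurable
  calc (∫⁻ x, f x * g x ∂μ) ^ 2 ≤ _ := pow_le_pow_left' h 2
    _ = _ := by
      rw [mul_pow, ← ENNReal.rpow_natCast, ← ENNReal.rpow_mul, ← ENNReal.rpow_natCast,
        ← ENNReal.rpow_mul]
      norm_num [mul_comm]

lemma ChiBound.refl (P : Measure α) [IsProbabilityMeasure P] : ChiBound 1 P P := by
  intro f hf
  simpa using sq_lintegral_mul_le P hf (measurable_const (a := (1 : ℝ≥0∞)))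

lemma ChiBound.mono {A B : ℝ≥0∞} {P Q : Measure α} (h : ChiBound A P Q) (hAB : A ≤ B) :
    ChiBound B P Q :=
  fun f hf => (h f hf).trans (by gcongr)

lemma ChiBound.map {A : ℝ≥0∞} {P Q : Measure α} (h : ChiBound A P Q) {g : α → β}
    (hg : Measurable g) : ChiBound A (P.map g) (Q.map g) := by
  intro f hf
  rw [lintegral_map hf hg, lintegral_map (by fun_prop) hg]
  exact h _ (hf.comp hg)

/-- By Tonelli, one inequality applies to the partial integral and the other to each slice, so no
densities have to be multiplied. -/
lemma ChiBound.prod {A B : ℝ≥0∞} {P Q : Measure α} {P' Q' : Measure β} [SFinite P]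
    [SFinite Q] [SFinite P'] [SFinite Q'] (h : ChiBound A P Q) (h' : ChiBound B P' Q') :
    ChiBound (A * B) (P.prod P') (Q.prod Q') := by
  intro f hf
  rw [lintegral_prod _ hf.aemeasurable, lintegral_prod _ (by fun_prop)]
  calc _ ≤ A * ∫⁻ x, (∫⁻ y, f (x, y) ∂P') ^ 2 ∂Q := h _ hf.lintegral_prod_right'
    _ ≤ A * ∫⁻ x, B * (∫⁻ y, f (x, y) ^ 2 ∂Q') ∂Q := by
      gcongr with x
      exact h' _ (hf.comp measurable_prodMk_left)
    _ = _ := by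
      rw [lintegral_const_mul _ (Measurable.lintegral_prod_right' (hf.pow_const 2)), mul_assoc]

lemma ChiBound.pi {A : ℝ≥0∞} {P Q : Measure α} [IsProbabilityMeasure P]
    [IsProbabilityMeasure Q] (h : ChiBound A P Q) (n : ℕ) :
    ChiBound (A ^ n) (Measure.pi fun _ : Fin n => P) (Measure.pi fun _ : Fin n => Q) := by
  induction n with
  | zero =>
    rw [pow_zero, Measure.pi_of_empty (fun _ : Fin 0 => P), Measure.pi_of_empty (fun _ : Fin 0 => Q)]
    exact ChiBound.refl _
  | succ n ih =>
    have hP := (measurePreserving_piFinSuccAbove (fun _ : Fin (n + 1) => P) 0).symm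
    have hQ := (measurePreserving_piFinSuccAbove (fun _ : Fin (n + 1) => Q) 0).symm
    rw [← hP.map_eq, ← hQ.map_eq, pow_succ']
    exact (h.prod ih).map hP.measurable

/-- Cauchy–Schwarz for the splitting `f p = (f √q) (p / √q)`. -/
lemma chiBound_withDensity (μ : Measure α) {p q : α → ℝ≥0∞} (hp : Measurable p)
    (hq : Measurable q) (hq0 : ∀ x, q x ≠ 0) (hqt : ∀ x, q x ≠ ∞) :
    ChiBound (∫⁻ x, p x ^ 2 / q x ∂μ) (μ.withDensity p) (μ.withDensity q) := by
  intro f hf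
  rw [lintegral_withDensity_eq_lintegral_mul _ hp hf,
    lintegral_withDensity_eq_lintegral_mul _ hq (by fun_prop)]
  have hs : ∀ x, (q x ^ (1 / 2 : ℝ)) ^ 2 = q x := fun x => by
    rw [← ENNReal.rpow_natCast, ← ENNReal.rpow_mul]; norm_num
  have hs0 : ∀ x, q x ^ (1 / 2 : ℝ) ≠ 0 := fun x h => hq0 x (by rw [← hs x, h]; simp)
  have hst : ∀ x, q x ^ (1 / 2 : ℝ) ≠ ∞ := fun x h => hqt x (by rw [← hs x, h]; simp)
  have h := sq_lintegral_mul_le μ (f := fun x => f x * q x ^ (1 / 2 : ℝ))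
    (g := fun x => p x / q x ^ (1 / 2 : ℝ)) (by fun_prop) (by fun_prop)
  have e1 : ∫⁻ x, (p * f) x ∂μ = ∫⁻ x, f x * q x ^ (1 / 2 : ℝ) * (p x / q x ^ (1 / 2 : ℝ)) ∂μ :=
    lintegral_congr fun x => by
      rw [Pi.mul_apply, mul_assoc, ENNReal.mul_div_cancel (hs0 x) (hst x), mul_comm]
  have e2 : ∫⁻ x, p x ^ 2 / q x ∂μ = ∫⁻ x, (p x / q x ^ (1 / 2 : ℝ)) ^ 2 ∂μ :=
    lintegral_congr fun x => by
      rw [div_eq_mul_inv, div_eq_mul_inv, mul_pow, ← ENNReal.inv_pow, hs x]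
  have e3 : ∫⁻ x, (q * fun x => f x ^ 2) x ∂μ = ∫⁻ x, (f x * q x ^ (1 / 2 : ℝ)) ^ 2 ∂μ :=
    lintegral_congr fun x => by
      rw [Pi.mul_apply, mul_pow, hs x, mul_comm]
  rwa [e1, e2, e3]

end ChiBound

/-- The second moment of the density of `N(0, 1 + t)` with respect to `N(0, 1)`. -/
lemma chiBound_gaussianReal {t : ℝ} (ht : |t| < 1) :
    ChiBound (ENNReal.ofReal (1 / √(1 - t ^ 2))) (gaussianReal 0 (1 + t).toNNReal)
      (gaussianReal 0 1) := by
  obtain ⟨h1, h2⟩ := abs_lt.1 ht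
  have hv : ((1 + t).toNNReal : ℝ) = 1 + t := Real.coe_toNNReal _ (by linarith)
  have hv0 : (1 + t).toNNReal ≠ 0 := by simpa using by linarith
  rw [gaussianReal_of_var_ne_zero _ hv0, gaussianReal_of_var_ne_zero _ one_ne_zero]
  refine (chiBound_withDensity volume (measurable_gaussianPDF _ _) (measurable_gaussianPDF _ _)
    (fun x => (gaussianPDF_pos _ one_ne_zero x).ne') (fun x => gaussianPDF_ne_top)).mono
    (le_of_eq ?_)
  -- This is the Gaussian decay rate of the ratio: `1/(1+t) - 1/2`.
  have hb : 0 < (1 - t) / (2 * (1 + t)) := div_pos (by linarith) (by linarith)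
  have key : ∀ x : ℝ, gaussianPDF 0 (1 + t).toNNReal x ^ 2 / gaussianPDF 0 1 x =
      ENNReal.ofReal ((1 / ((1 + t) * √(2 * Real.pi))) *
        Real.exp (-((1 - t) / (2 * (1 + t))) * x ^ 2)) := by
    intro x
    rw [gaussianPDF, gaussianPDF, ← ENNReal.ofReal_pow (gaussianPDFReal_nonneg _ _ _),
      ← ENNReal.ofReal_div_of_pos (gaussianPDFReal_pos _ _ _ one_ne_zero)]
    congr 1
    have hpi := Real.pi_pos
    rw [gaussianPDFReal, gaussianPDFReal, hv, mul_pow, ← Real.exp_nat_mul, NNReal.coe_one,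
      mul_div_mul_comm, ← Real.exp_sub, inv_pow, Real.sq_sqrt (by nlinarith)]
    congr 1
    · have h3 : √(2 * Real.pi) ^ 2 = 2 * Real.pi := Real.sq_sqrt (by positivity)
      have h4 : √(2 * Real.pi) ≠ 0 := by positivity
      have h5 : (1 + t) ≠ 0 := by linarith
      rw [mul_one]
      field_simp
      rw [h3]
    · congr 1
      have h5 : (1 + t) ≠ 0 := by linarith
      push_cast
      field_simp
      ring
  simp_rw [key]
  rw [← ofReal_integral_eq_lintegral_ofReal ((integrable_exp_neg_mul_sq hb).const_mul _)
    (ae_of_all _ fun x => mul_nonneg (one_div_nonneg.2 (mul_nonneg (by linarith) (by positivity)))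
      (Real.exp_pos _).le), integral_const_mul, integral_gaussian]
  congr 1
  have h5 : 0 < 1 + t := by linarith
  have h6 : 0 < 1 - t := by linarith
  have hpi := Real.pi_pos
  rw [show Real.pi / ((1 - t) / (2 * (1 + t))) = (2 * Real.pi) * ((1 + t) ^ 2 / (1 - t ^ 2)) by
    rw [show 1 - t ^ 2 = (1 - t) * (1 + t) by ring]; field_simp]
  rw [Real.sqrt_mul (by positivity) ((1 + t) ^ 2 / (1 - t ^ 2)), Real.sqrt_div (by positivity), Real.sqrt_sq h5.le]
  have h7 : 0 < √(1 - t ^ 2) := Real.sqrt_pos.2 (by nlinarith)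
  field_simp

/-- Rests on `(1 - x)(1 + 2x) ≥ 1` for `0 ≤ x ≤ 1/2`; the exponential form makes `n`-fold powers
easy to handle. -/
lemma one_div_sqrt_one_sub_le_exp {x : ℝ} (h0 : 0 ≤ x) (h : x ≤ 1 / 2) :
    1 / √(1 - x) ≤ Real.exp x := by
  have h1 : Real.exp (-(2 * x)) ≤ 1 - x := by
    have h2 : (1 - x) * (1 + 2 * x) ≥ 1 := by nlinarith
    have h3 := Real.add_one_le_exp (2 * x)
    rw [Real.exp_neg, inv_le_iff_one_le_mul₀ (Real.exp_pos _)]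
    nlinarith
  have h4 : Real.exp (-x) ≤ √(1 - x) := by
    apply Real.le_sqrt_of_sq_le
    rw [← Real.exp_nat_mul]
    convert h1 using 2
    push_cast; ring
  rw [div_le_iff₀ (lt_of_lt_of_le (Real.exp_pos _) h4)]
  calc (1 : ℝ) = Real.exp x * Real.exp (-x) := by rw [← Real.exp_add]; simp
    _ ≤ _ := by gcongr

variable {p : ℕ}

/-! ### Spiked covariances and their Gaussian laws. -/

/-- The spiked covariance matrix `m (I + t v vᵀ)`. -/
def spike (m t : ℝ) (v : EuclideanSpace ℝ (Fin p)) : Matrix (Fin p) (Fin p) ℝ :=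
  m • (1 + t • Matrix.vecMulVec v.ofLp v.ofLp)

lemma spike_mulVec (m t : ℝ) (v x : EuclideanSpace ℝ (Fin p)) :
    Matrix.mulVec (spike m t v) x.ofLp = (m • (x + (t * ⟪v, x⟫) • v)).ofLp := by
  have h : v.ofLp ⬝ᵥ x.ofLp = ⟪v, x⟫ := by
    simp [PiLp.inner_apply, dotProduct, mul_comm]
  rw [spike, Matrix.smul_mulVec, Matrix.add_mulVec, Matrix.smul_mulVec, Matrix.one_mulVec,
    Matrix.vecMulVec_mulVec, h]
  ext i
  simp
  ring_nf

lemma toEuclideanCLM_spike (m t : ℝ) (v x : EuclideanSpace ℝ (Fin p)) :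
    Matrix.toEuclideanCLM (n := Fin p) (𝕜 := ℝ) (spike m t v) x =
      m • (x + (t * ⟪v, x⟫) • v) := by
  have := Matrix.toEuclideanCLM_toLp (𝕜 := ℝ) (spike m t v) x.ofLp
  rw [spike_mulVec] at this
  exact this

lemma inner_spike (m t : ℝ) (v x : EuclideanSpace ℝ (Fin p)) :
    x.ofLp ⬝ᵥ Matrix.mulVec (spike m t v) x.ofLp = m * (‖x‖ ^ 2 + t * ⟪v, x⟫ ^ 2) := by
  have h : ∀ a b : EuclideanSpace ℝ (Fin p), a.ofLp ⬝ᵥ b.ofLp = ⟪a, b⟫ := fun a b => by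
    simp [PiLp.inner_apply, dotProduct, mul_comm]
  rw [spike_mulVec, h, inner_smul_right, inner_add_right, inner_smul_right,
    real_inner_self_eq_norm_sq, real_inner_comm v x]
  ring

lemma sq_inner_le_of_norm_eq_one {v : EuclideanSpace ℝ (Fin p)} (hv : ‖v‖ = 1)
    (x : EuclideanSpace ℝ (Fin p)) : ⟪v, x⟫ ^ 2 ≤ ‖x‖ ^ 2 := by
  have := abs_real_inner_le_norm v x
  rw [hv, one_mul] at this
  exact sq_le_sq' (by linarith [abs_le.1 this]) (abs_le.1 this).2

lemma spike_posSemidef {m t : ℝ} (hm : 0 ≤ m) (ht : -1 ≤ t) {v : EuclideanSpace ℝ (Fin p)}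
    (hv : ‖v‖ = 1) : (spike m t v).PosSemidef := by
  refine Matrix.PosSemidef.of_dotProduct_mulVec_nonneg ?_ fun x => ?_
  · ext i j
    simp [spike, Matrix.vecMulVec_apply, Matrix.one_apply, mul_comm, eq_comm, mul_add]
  · have := inner_spike m t v (WithLp.toLp 2 x)
    simp only [star_trivial]
    simp only at this
    rw [this]
    refine mul_nonneg hm ?_
    nlinarith [sq_inner_le_of_norm_eq_one hv (WithLp.toLp 2 x), sq_nonneg ⟪v, WithLp.toLp 2 x⟫]

/-- The quadratic form at an eigenvector `x` is `m (‖x‖² + t ⟪v, x⟫²)` with `⟪v, x⟫² ≤ ‖x‖²`, so its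
eigenvalue lies between `m` and `m (1 + t)`. -/
lemma spike_mem_covClass {M₁ M₂ m t : ℝ} (hm : 0 ≤ m) (ht : -1 ≤ t) (h1 : M₁ ≤ m)
    (h2 : m ≤ M₂) (h3 : M₁ ≤ m * (1 + t)) (h4 : m * (1 + t) ≤ M₂)
    {v : EuclideanSpace ℝ (Fin p)} (hv : ‖v‖ = 1) : spike m t v ∈ covClass p M₁ M₂ := by
  refine ⟨spike_posSemidef hm ht hv, fun μ hμ => ?_⟩
  rw [← Matrix.spectrum_toLin', ← Module.End.hasEigenvalue_iff_mem_spectrum] at hμ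
  obtain ⟨y, hy⟩ := hμ.exists_hasEigenvector
  have h0 : Matrix.mulVec (spike m t v) y = μ • y := by simpa using hy.apply_eq_smul
  set x : EuclideanSpace ℝ (Fin p) := WithLp.toLp 2 y
  have hx : 0 < ‖x‖ ^ 2 := by
    have : x ≠ 0 := by simpa [x] using hy.2
    positivity
  have h5 := inner_spike m t v x
  have h6 : y ⬝ᵥ y = ‖x‖ ^ 2 := by
    rw [EuclideanSpace.real_norm_sq_eq]; simp [x, dotProduct, sq]
  simp only [x] at h5
  rw [h0, dotProduct_smul, h6, smul_eq_mul] at h5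
  have h7 := sq_inner_le_of_norm_eq_one hv x
  have h8 := sq_nonneg ⟪v, x⟫
  constructor
  · refine le_of_mul_le_mul_right ?_ hx
    rw [h5]
    nlinarith
  · refine le_of_mul_le_mul_right ?_ hx
    rw [h5]
    nlinarith

lemma charFun_gaussian_spike {m t : ℝ} (hm : 0 ≤ m) (ht : -1 ≤ t)
    {v : EuclideanSpace ℝ (Fin p)} (hv : ‖v‖ = 1) (y : EuclideanSpace ℝ (Fin p)) :
    charFun (multivariateGaussian 0 (spike m t v)) y =
      Complex.exp ((-(m * (‖y‖ ^ 2 + t * ⟪v, y⟫ ^ 2)) / 2 : ℝ)) := by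
  rw [charFun_multivariateGaussian (spike_posSemidef hm ht hv)]
  have h := inner_spike m t v y
  congr 1
  simp only [inner_zero_right, Complex.ofReal_zero, zero_mul, zero_sub]
  rw [← Complex.ofReal_ofNat, ← Complex.ofReal_div, ← Complex.ofReal_neg, h, neg_div]

lemma norm_sq_sub_smul {v : EuclideanSpace ℝ (Fin p)} (hv : ‖v‖ = 1) (a : ℝ)
    (y : EuclideanSpace ℝ (Fin p)) :
    ‖y - (a * ⟪v, y⟫) • v‖ ^ 2 = ‖y‖ ^ 2 - (2 * a - a ^ 2) * ⟪v, y⟫ ^ 2 := by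
  rw [norm_sub_sq_real, norm_smul, hv, inner_smul_right, real_inner_comm v y, mul_one,
    Real.norm_eq_abs, sq_abs]
  ring

/-- A Gaussian vector with a spiked covariance is obtained from a standard one by resampling the
coordinate along the spike. -/
lemma map_gaussian_spike {m t : ℝ} (hm : 0 ≤ m) (ht : -1 ≤ t)
    {v : EuclideanSpace ℝ (Fin p)} (hv : ‖v‖ = 1) :
    ((stdGaussian (EuclideanSpace ℝ (Fin p))).prod (gaussianReal 0 (1 + t).toNNReal)).map
      (fun z => √m • (z.1 - ⟪v, z.1⟫ • v + z.2 • v)) = multivariateGaussian 0 (spike m t v) := by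
  have hmeas : Measurable fun z : EuclideanSpace ℝ (Fin p) × ℝ =>
      √m • (z.1 - ⟪v, z.1⟫ • v + z.2 • v) := by fun_prop
  have : IsProbabilityMeasure (((stdGaussian (EuclideanSpace ℝ (Fin p))).prod
      (gaussianReal 0 (1 + t).toNNReal)).map
      (fun z => √m • (z.1 - ⟪v, z.1⟫ • v + z.2 • v))) :=
    Measure.isProbabilityMeasure_map hmeas.aemeasurable
  apply Measure.ext_of_charFun
  ext y
  rw [charFun_gaussian_spike hm ht hv, charFun_apply, integral_map hmeas.aemeasurable
    (Measurable.aestronglyMeasurable (by fun_prop))]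
  have h : ∀ z : EuclideanSpace ℝ (Fin p) × ℝ,
      Complex.exp (⟪√m • (z.1 - ⟪v, z.1⟫ • v + z.2 • v), y⟫ * Complex.I) =
      Complex.exp (⟪z.1, √m • (y - (1 * ⟪v, y⟫) • v)⟫ * Complex.I) *
        Complex.exp (⟪z.2, √m * ⟪v, y⟫⟫ * Complex.I) := by
    intro z
    rw [← Complex.exp_add, ← add_mul, ← Complex.ofReal_add]
    congr 3
    simp only [inner_smul_left, inner_smul_right, inner_add_left, inner_sub_left,
      inner_sub_right, real_inner_comm v z.1]
    simp
    ring
  simp_rw [h]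
  rw [integral_prod_mul (f := fun x : EuclideanSpace ℝ (Fin p) =>
      Complex.exp (⟪x, √m • (y - (1 * ⟪v, y⟫) • v)⟫ * Complex.I))
    (g := fun x : ℝ => Complex.exp (⟪x, √m * ⟪v, y⟫⟫ * Complex.I)),
    ← charFun_apply, ← charFun_apply, charFun_stdGaussian, charFun_gaussianReal,
    ← Complex.exp_add, Real.coe_toNNReal _ (by linarith)]
  congr 1
  rw [norm_smul, Real.norm_of_nonneg (Real.sqrt_nonneg _)]
  push_cast
  simp only [mul_pow]
  have h1 : ((√m : ℝ) : ℂ) ^ 2 = m := by rw [← Complex.ofReal_pow, Real.sq_sqrt hm]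
  have h2 := congrArg (fun r : ℝ => (r : ℂ)) (norm_sq_sub_smul hv 1 y)
  push_cast at h2
  rw [h1, h2]
  ring

/-- In the representation of `map_gaussian_spike` only the real resampled variable depends on `t`,
so the comparison is one-dimensional and its constant does not involve `p`. The reference law is the
same image with `t = 0`. -/
lemma chiBound_gaussian_spike {m t : ℝ} (hm : 0 ≤ m) (ht : t ^ 2 ≤ 1 / 2)
    {v : EuclideanSpace ℝ (Fin p)} (hv : ‖v‖ = 1) (n : ℕ) :
    ChiBound (ENNReal.ofReal (Real.exp (n * t ^ 2)))
      (Measure.pi fun _ : Fin n => multivariateGaussian 0 (spike m t v))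
      (Measure.pi fun _ : Fin n => multivariateGaussian 0 (m • (1 : Matrix (Fin p) (Fin p) ℝ))) := by
  have h1 : |t| < 1 := by rw [abs_lt]; constructor <;> nlinarith
  have h0 : m • (1 : Matrix (Fin p) (Fin p) ℝ) = spike m 0 v := by simp [spike]
  have h2 := ((ChiBound.refl (stdGaussian (EuclideanSpace ℝ (Fin p)))).prod
    ((chiBound_gaussianReal h1).mono (ENNReal.ofReal_le_ofReal
      (one_div_sqrt_one_sub_le_exp (sq_nonneg t) ht)))).map
    (g := fun z : EuclideanSpace ℝ (Fin p) × ℝ => √m • (z.1 - ⟪v, z.1⟫ • v + z.2 • v))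
    (by fun_prop)
  have h3 := map_gaussian_spike hm (t := 0) (by norm_num) hv
  rw [add_zero, Real.toNNReal_one] at h3
  rw [map_gaussian_spike hm (by linarith [abs_lt.1 h1]) hv, h3, one_mul] at h2
  rw [h0, Real.exp_nat_mul, ENNReal.ofReal_pow (Real.exp_pos _).le]
  exact h2.pi n

/-- Shrinking a Gaussian vector along `v` turns the covariance `m I` into a spiked one. -/
lemma map_sub_gaussian_spike {m a : ℝ} (hm : 0 ≤ m) {v : EuclideanSpace ℝ (Fin p)}
    (hv : ‖v‖ = 1) :
    (multivariateGaussian 0 (spike m 0 v)).map (fun x => x - (a * ⟪v, x⟫) • v) =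
      multivariateGaussian 0 (spike m (-(2 * a - a ^ 2)) v) := by
  have hmeas : Measurable fun x : EuclideanSpace ℝ (Fin p) => x - (a * ⟪v, x⟫) • v := by
    fun_prop
  have : IsProbabilityMeasure ((multivariateGaussian 0 (spike m 0 v)).map
      (fun x => x - (a * ⟪v, x⟫) • v)) :=
    Measure.isProbabilityMeasure_map hmeas.aemeasurable
  apply Measure.ext_of_charFun
  ext y
  rw [charFun_gaussian_spike hm (by nlinarith [sq_nonneg (a - 1)]) hv, charFun_apply,
    integral_map hmeas.aemeasurable (Measurable.aestronglyMeasurable (by fun_prop))]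
  have h : ∀ x : EuclideanSpace ℝ (Fin p), ⟪x - (a * ⟪v, x⟫) • v, y⟫ =
      ⟪x, y - (a * ⟪v, y⟫) • v⟫ := by
    intro x
    rw [inner_sub_left, inner_sub_right, inner_smul_left, inner_smul_right, real_inner_comm v x]
    simp
    ring
  simp_rw [h]
  rw [← charFun_apply, charFun_gaussian_spike hm (by norm_num) hv, norm_sq_sub_smul hv]
  congr 3
  ring

lemma map_inner_gaussian_spike {m : ℝ} (hm : 0 ≤ m) {v : EuclideanSpace ℝ (Fin p)}
    (hv : ‖v‖ = 1) :
    (multivariateGaussian 0 (spike m 0 v)).map (fun x => ⟪v, x⟫) =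
      gaussianReal 0 m.toNNReal := by
  have : IsProbabilityMeasure ((multivariateGaussian 0 (spike m 0 v)).map (fun x => ⟪v, x⟫)) :=
    Measure.isProbabilityMeasure_map (by fun_prop)
  apply Measure.ext_of_charFun
  ext y
  rw [charFun_gaussianReal, charFun_apply,
    integral_map (by fun_prop) (Measurable.aestronglyMeasurable (by fun_prop))]
  have h : ∀ x : EuclideanSpace ℝ (Fin p), ⟪(⟪v, x⟫ : ℝ), y⟫ = ⟪x, y • v⟫ := by
    intro x
    rw [inner_smul_right, real_inner_comm v x]
    simp
  simp_rw [h]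
  rw [← charFun_apply, charFun_gaussian_spike hm (by norm_num) hv, norm_smul, hv,
    Real.coe_toNNReal _ hm]
  congr 1
  simp
  ring

/-! ### Spectral norm: separation and measurability. -/

section SpecNorm

lemma specNorm_sub_comm (A B : Matrix (Fin p) (Fin p) ℝ) : specNorm (A - B) = specNorm (B - A) := by
  rw [specNorm, specNorm, map_sub, map_sub, norm_sub_rev]

lemma specNorm_sub_le (A B T : Matrix (Fin p) (Fin p) ℝ) :
    specNorm (A - B) ≤ specNorm (A - T) + specNorm (B - T) := by
  rw [specNorm_sub_comm B T]
  simp only [specNorm, map_sub]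
  exact norm_sub_le_norm_sub_add_norm_sub _ _ _

lemma abs_quadForm_le_specNorm (A : Matrix (Fin p) (Fin p) ℝ) {v : EuclideanSpace ℝ (Fin p)}
    (hv : ‖v‖ = 1) :
    |⟪v, Matrix.toEuclideanCLM (n := Fin p) (𝕜 := ℝ) A v⟫| ≤ specNorm A := by
  have h1 := abs_real_inner_le_norm v (Matrix.toEuclideanCLM (n := Fin p) (𝕜 := ℝ) A v)
  have h2 := (Matrix.toEuclideanCLM (n := Fin p) (𝕜 := ℝ) A).le_opNorm v
  rw [hv] at h1 h2
  rw [specNorm]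
  linarith

/-- Test the quadratic form of the difference in the direction `v`. -/
lemma abs_le_specNorm_spike_sub {m t s : ℝ} {v w : EuclideanSpace ℝ (Fin p)} (hv : ‖v‖ = 1) :
    |m * (t - s * ⟪w, v⟫ ^ 2)| ≤ specNorm (spike m t v - spike m s w) := by
  refine le_trans (le_of_eq ?_) (abs_quadForm_le_specNorm _ hv)
  rw [map_sub, sub_apply, toEuclideanCLM_spike, toEuclideanCLM_spike]
  congr 1
  simp only [inner_sub_right, inner_smul_right, inner_add_right, real_inner_self_eq_norm_sq, hv,
    real_inner_comm v w]
  ring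

lemma measurable_specNorm_sub {Ω : Type*} [MeasurableSpace Ω]
    {T : Ω → Matrix (Fin p) (Fin p) ℝ} (hT : ∀ i j, Measurable fun x => T x i j)
    (S : Matrix (Fin p) (Fin p) ℝ) : Measurable fun x => specNorm (S - T x) := by
  let L : (Fin p → Fin p → ℝ) →ₗ[ℝ] EuclideanSpace ℝ (Fin p) →L[ℝ] EuclideanSpace ℝ (Fin p) :=
    { toFun := fun A => Matrix.toEuclideanCLM (n := Fin p) (𝕜 := ℝ) (Matrix.of A)
      map_add' := fun A B => map_add (Matrix.toEuclideanCLM (n := Fin p) (𝕜 := ℝ)) _ _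
      map_smul' := fun c A => map_smul (Matrix.toEuclideanCLM (n := Fin p) (𝕜 := ℝ)) _ _ }
  have hL : Continuous fun A => ‖L A‖ := L.continuous_of_finiteDimensional.norm
  exact hL.measurable.comp (measurable_pi_lambda _ fun i => measurable_pi_lambda _ fun j =>
    (measurable_const (a := S i j)).sub (hT i j))

end SpecNorm

/-! ### Testing many hypotheses. -/

section Testing

/-- Several hypotheses at bounded chi-square distance from a common one cannot all be recognised
with high probability, if the acceptance regions overlap at most `M` times. -/
lemma card_mul_sq_le_of_chiBound {ι Ω : Type*} [Fintype ι] [MeasurableSpace Ω] {A c : ℝ≥0∞}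
    {M : ℕ} {P : ι → Measure Ω} {Q : Measure Ω} [IsProbabilityMeasure Q]
    (h : ∀ i, ChiBound A (P i) Q) {B : ι → Set Ω} (hB : ∀ i, MeasurableSet (B i))
    (hM : ∀ x, {i | x ∈ B i}.ncard ≤ M) (hc : ∀ i, c ≤ P i (B i)) :
    (Fintype.card ι : ℝ≥0∞) * c ^ 2 ≤ A * M := by
  classical
  -- On an indicator the chi-square bound reads `P(B)² ≤ A Q(B)`; the masses `Q (B i)` then sum to
  -- at most `M`.
  have h1 : ∀ i, c ^ 2 ≤ A * Q (B i) := fun i => by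
    have h2 := h i ((B i).indicator 1) (measurable_one.indicator (hB i))
    have h3 : ∀ x, (B i).indicator (1 : Ω → ℝ≥0∞) x ^ 2 = (B i).indicator 1 x := fun x => by
      by_cases hx : x ∈ B i <;> simp [hx]
    simp_rw [h3, lintegral_indicator_one (hB i)] at h2
    exact (pow_le_pow_left' (hc i) 2).trans h2
  calc (Fintype.card ι : ℝ≥0∞) * c ^ 2 = ∑ _i : ι, c ^ 2 := by simp
    _ ≤ ∑ i, A * Q (B i) := Finset.sum_le_sum fun i _ => h1 i
    _ = A * ∫⁻ x, ∑ i, (B i).indicator 1 x ∂Q := by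
      rw [← Finset.mul_sum, lintegral_finsetSum _ fun i _ => measurable_one.indicator (hB i)]
      simp_rw [lintegral_indicator_one (hB _)]
    _ ≤ A * ∫⁻ _x, (M : ℝ≥0∞) ∂Q := by
      gcongr with x
      have : ∑ i, (B i).indicator (1 : Ω → ℝ≥0∞) x = ({i | x ∈ B i}.ncard : ℝ≥0∞) := by
        simp [Set.indicator_apply, Set.ncard_eq_toFinset_card']
      rw [this]
      exact_mod_cast hM x
    _ = A * M := by simp

end Testing

/-! ### Correlations of sign vectors. -/

section SignVectors

/-- The sign attached to a Boolean. -/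
def boolSign (b : Bool) : ℝ := if b then 1 else -1

lemma boolSign_sq (b : Bool) : boolSign b ^ 2 = 1 := by cases b <;> simp [boolSign]

/-- The unit vector with entries `± 1 / √p`. -/
def signVec (b : Fin p → Bool) : EuclideanSpace ℝ (Fin p) :=
  WithLp.toLp 2 fun i => boolSign (b i) / √p

lemma norm_signVec (hp : 1 ≤ p) (b : Fin p → Bool) : ‖signVec b‖ = 1 := by
  have hp0 : (p : ℝ) ≠ 0 := by positivity
  have h : ‖signVec b‖ ^ 2 = 1 := by
    rw [EuclideanSpace.real_norm_sq_eq]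
    simp [signVec, div_pow, boolSign_sq, hp0]
  exact (pow_eq_one_iff_of_nonneg (norm_nonneg _) two_ne_zero).1 h

lemma inner_signVec (b w : Fin p → Bool) :
    ⟪signVec b, signVec w⟫ = (∑ i, boolSign (b i) * boolSign (w i)) / p := by
  rw [Finset.sum_div, PiLp.inner_apply]
  refine Finset.sum_congr rfl fun i _ => ?_
  have : (√p) * √p = (p : ℝ) := Real.mul_self_sqrt (by positivity)
  simp only [signVec, RCLike.inner_apply, conj_trivial]
  rw [div_mul_div_comm, this, mul_comm]

/-- The sum factorises over coordinates into terms `2 cosh a`, and `cosh a ≤ exp (a²/2)`. -/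
lemma sum_exp_signs_le (w : Fin p → Bool) {a : ℝ} (ha : a ^ 2 = 1 / 4) :
    ∑ b : Fin p → Bool, Real.exp (a * ∑ i, boolSign (b i) * boolSign (w i)) ≤
      2 ^ p * Real.exp (p / 8) := by
  simp_rw [Finset.mul_sum, Real.exp_sum]
  rw [← Fintype.prod_sum (fun i (b : Bool) => Real.exp (a * (boolSign b * boolSign (w i))))]
  calc _ ≤ ∏ _i : Fin p, (2 * Real.exp (1 / 8)) := by
        refine Finset.prod_le_prod (fun i _ => by positivity) fun i _ => ?_
        have h1 := Real.cosh_le_exp_half_sq (a * boolSign (w i))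
        rw [mul_pow, ha, boolSign_sq, Real.cosh_eq] at h1
        norm_num at h1 ⊢
        simp only [boolSign, if_true, Bool.false_eq_true, if_false] at h1 ⊢
        have h2 : ∀ x : ℝ, a * (-1 * x) = -(a * x) := fun x => by ring
        rw [one_mul, h2]
        linarith
    _ = _ := by
      rw [Finset.prod_const, Finset.card_univ, Fintype.card_fin, mul_pow, ← Real.exp_nat_mul]
      congr 2
      ring

/-- Chernoff's bound at parameters `± 1/2`: each tail contributes `2 ^ p * exp (p/8 - p/4)`. -/
lemma card_correlated_le (w : Fin p → Bool) :
    ({b : Fin p → Bool | (p : ℝ) / 2 < |∑ i, boolSign (b i) * boolSign (w i)|}.ncard : ℝ) ≤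
      2 * 2 ^ p * Real.exp (-(p / 8)) := by
  classical
  rw [Set.ncard_eq_toFinset_card']
  set F := {b : Fin p → Bool |
    (p : ℝ) / 2 < |∑ i, boolSign (b i) * boolSign (w i)|}.toFinset with hF
  have h1 : (F.card : ℝ) * Real.exp (p / 4) ≤
      ∑ b : Fin p → Bool, (Real.exp (1 / 2 * ∑ i, boolSign (b i) * boolSign (w i)) +
        Real.exp (-1 / 2 * ∑ i, boolSign (b i) * boolSign (w i))) := by
    rw [← nsmul_eq_mul, ← Finset.sum_const]
    refine le_trans (Finset.sum_le_sum fun b hb => ?_)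
      (Finset.sum_le_sum_of_subset_of_nonneg (Finset.subset_univ F) fun _ _ _ => by positivity)
    simp only [hF, Set.mem_toFinset, Set.mem_ofPred_eq] at hb
    set s := ∑ i, boolSign (b i) * boolSign (w i)
    rcases lt_abs.1 hb with h | h
    · have h2 : Real.exp (p / 4) ≤ Real.exp (1 / 2 * s) := Real.exp_le_exp.2 (by linarith)
      linarith [Real.exp_pos (-1 / 2 * s)]
    · have h2 : Real.exp (p / 4) ≤ Real.exp (-1 / 2 * s) := Real.exp_le_exp.2 (by linarith)
      linarith [Real.exp_pos (1 / 2 * s)]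
  rw [Finset.sum_add_distrib] at h1
  have h2 := sum_exp_signs_le w (a := 1 / 2) (by norm_num)
  have h3 := sum_exp_signs_le w (a := -1 / 2) (by norm_num)
  have h4 : Real.exp (-(p / 8 : ℝ)) * Real.exp (p / 4) = Real.exp (p / 8) := by
    rw [← Real.exp_add]; congr 1; ring
  refine le_of_mul_le_mul_right ?_ (Real.exp_pos ((p : ℝ) / 4))
  rw [mul_assoc, h4]
  linarith

end SignVectors

/-! ### Wasserstein bounds by explicit couplings. -/

lemma W1_le {P Q : Measure (EuclideanSpace ℝ (Fin p))}
    {π : Measure (EuclideanSpace ℝ (Fin p) × EuclideanSpace ℝ (Fin p))} (h : IsCoupling π P Q) :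
    W1 P Q ≤ ∫⁻ z, ‖z.1 - z.2‖ₑ ∂π :=
  iInf₂_le (f := fun π (_ : IsCoupling π P Q) => ∫⁻ z, ‖z.1 - z.2‖ₑ ∂π) π h

lemma W1_self (P : Measure (EuclideanSpace ℝ (Fin p))) : W1 P P = 0 := by
  refine le_antisymm ?_ zero_le
  have hm : Measurable fun x : EuclideanSpace ℝ (Fin p) => (x, x) := by fun_prop
  have hc : IsCoupling (P.map fun x => (x, x)) P P := by
    constructor
    · rw [Measure.map_map measurable_fst hm]
      exact Measure.map_id
    · rw [Measure.map_map measurable_snd hm]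
      exact Measure.map_id
  refine (W1_le hc).trans ?_
  rw [lintegral_map (by fun_prop) hm]
  simp

lemma gaussian_mem_contaminated (S : Matrix (Fin p) (Fin p) ℝ) (ε : ℝ) :
    multivariateGaussian 0 S ∈ contaminated S ε :=
  ⟨inferInstance, by rw [W1_self]; exact zero_le⟩

/-- Couple `x` with its shrunken copy: the displacement is `a |⟪v, x⟫|`, and `⟪v, x⟫` has law `N(0,
m)`. -/
lemma W1_spike_le {m a : ℝ} (hm : 0 ≤ m) (ha : 0 ≤ a) {v : EuclideanSpace ℝ (Fin p)}
    (hv : ‖v‖ = 1) :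
    W1 (multivariateGaussian 0 (spike m (-(2 * a - a ^ 2)) v))
      (multivariateGaussian 0 (spike m 0 v)) ≤
      ENNReal.ofReal a * ∫⁻ x, ‖x‖ₑ ∂(gaussianReal 0 m.toNNReal) := by
  have hm' : Measurable fun x : EuclideanSpace ℝ (Fin p) => (x - (a * ⟪v, x⟫) • v, x) := by
    fun_prop
  have hc : IsCoupling ((multivariateGaussian 0 (spike m 0 v)).map
      fun x => (x - (a * ⟪v, x⟫) • v, x))
      (multivariateGaussian 0 (spike m (-(2 * a - a ^ 2)) v))
      (multivariateGaussian 0 (spike m 0 v)) := by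
    constructor
    · rw [Measure.map_map measurable_fst hm']
      exact map_sub_gaussian_spike hm hv
    · rw [Measure.map_map measurable_snd hm']
      exact Measure.map_id
  refine (W1_le hc).trans ?_
  rw [lintegral_map (by fun_prop) hm', ← map_inner_gaussian_spike hm hv,
    lintegral_map (by fun_prop) (by fun_prop), ← lintegral_const_mul _ (by fun_prop)]
  refine lintegral_mono fun x => le_of_eq ?_
  rw [show x - (a * ⟪v, x⟫) • v - x = -((a * ⟪v, x⟫) • v) by abel, enorm_neg, enorm_smul,
    enorm_mul, Real.enorm_of_nonneg ha, ← ofReal_norm v, hv, ENNReal.ofReal_one,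
    mul_one]

/-! ### The two minimax lower bounds. -/

/-- Two separated parameters with a common contamination. -/
lemma half_le_minimaxProb {n : ℕ} {M₁ M₂ ε r : ℝ} {S S' : Matrix (Fin p) (Fin p) ℝ}
    (hS : S ∈ covClass p M₁ M₂) (hS' : S' ∈ covClass p M₁ M₂)
    {P : Measure (EuclideanSpace ℝ (Fin p))} (hP : P ∈ contaminated S ε)
    (hP' : P ∈ contaminated S' ε) (hr : 2 * r ≤ specNorm (S - S')) :
    2⁻¹ ≤ minimaxProb n p M₁ M₂ ε r := by
  refine le_iInf₂ fun T hT => ?_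
  have := hP.1
  set R := ⨆ S ∈ covClass p M₁ M₂, ⨆ P ∈ contaminated S ε,
    (Measure.pi fun _ : Fin n => P) {X | r ≤ specNorm (S - T X)}
  have h1 : (Measure.pi fun _ : Fin n => P) {X | r ≤ specNorm (S - T X)} ≤ R :=
    (le_iSup₂_of_le S hS (le_iSup₂_of_le P hP le_rfl))
  have h2 : (Measure.pi fun _ : Fin n => P) {X | r ≤ specNorm (S' - T X)} ≤ R :=
    (le_iSup₂_of_le S' hS' (le_iSup₂_of_le P hP' le_rfl))
  have h3 : (1 : ℝ≥0∞) ≤ R + R := by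
    calc (1 : ℝ≥0∞) = (Measure.pi fun _ : Fin n => P) Set.univ := by simp
      _ ≤ (Measure.pi fun _ : Fin n => P)
          ({X | r ≤ specNorm (S - T X)} ∪ {X | r ≤ specNorm (S' - T X)}) := by
        refine measure_mono fun X _ => ?_
        by_contra hX
        simp only [Set.mem_union, Set.mem_ofPred_eq, not_or, not_le] at hX
        linarith [specNorm_sub_le S S' (T X)]
      _ ≤ _ := (measure_union_le _ _).trans (add_le_add h1 h2)
  rw [← two_mul] at h3
  rwa [ENNReal.inv_le_iff_le_mul (by simp) (by simp)]

/-- The sampling error alone: random spikes along sign vectors. -/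
lemma eighth_le_minimaxProb {n : ℕ} {M₁ M₂ ε r m τ : ℝ} (hp : 1 ≤ p) (hm : 0 ≤ m) (hτ0 : 0 ≤ τ)
    (hτ : τ ^ 2 ≤ 1 / 2) (hn : n * τ ^ 2 ≤ p / 16) (h1 : M₁ ≤ m * (1 - τ))
    (h2 : m * (1 + τ) ≤ M₂) (hr : 2 * r ≤ 3 / 4 * (m * τ)) :
    ENNReal.ofReal (1 / 8) ≤ minimaxProb n p M₁ M₂ ε r := by
  refine le_iInf₂ fun T hT => ?_
  by_contra! hcon
  -- The extra sign doubles the number of hypotheses, which also supplies distinct matrices when `p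
  -- = 1`, where `v vᵀ` is always the same.
  set S : Bool × (Fin p → Bool) → Matrix (Fin p) (Fin p) ℝ :=
    fun i => spike m (boolSign i.1 * τ) (signVec i.2) with hS
  set P : Bool × (Fin p → Bool) → Measure (Fin n → EuclideanSpace ℝ (Fin p)) :=
    fun i => Measure.pi fun _ => multivariateGaussian 0 (S i) with hP
  have hPprob : ∀ i, IsProbabilityMeasure (P i) := fun i => by rw [hP]; infer_instance
  have hmt : 0 ≤ m * τ := mul_nonneg hm hτ0
  have hτ1 : τ ≤ 1 := by nlinarith
  have hsq : ∀ b, (boolSign b * τ) ^ 2 = τ ^ 2 := fun b => by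
    rw [mul_pow, boolSign_sq, one_mul]
  have hSmem : ∀ i, S i ∈ covClass p M₁ M₂ := by
    rintro ⟨σ, b⟩
    refine spike_mem_covClass hm ?_ ?_ ?_ ?_ ?_ (norm_signVec hp b)
    all_goals cases σ <;> norm_num [boolSign] <;> nlinarith
  have hmeas : ∀ i, MeasurableSet {X | specNorm (S i - T X) < r} := fun i =>
    measurableSet_lt (measurable_specNorm_sub hT (S i)) measurable_const
  have hB : ∀ i, ENNReal.ofReal (7 / 8) ≤ P i {X | specNorm (S i - T X) < r} := by
    intro i
    have h3 : P i {X | r ≤ specNorm (S i - T X)} < ENNReal.ofReal (1 / 8) :=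
      lt_of_le_of_lt (le_iSup₂_of_le (S i) (hSmem i)
        (le_iSup₂_of_le (f := fun P _ => (Measure.pi fun _ : Fin n => P) _)
          (multivariateGaussian 0 (S i)) (gaussian_mem_contaminated (S i) ε) le_rfl)) hcon
    have h4 : {X | r ≤ specNorm (S i - T X)} = {X | specNorm (S i - T X) < r}ᶜ := by
      ext X; simp
    rw [h4, prob_compl_eq_one_sub (hmeas i)] at h3
    have h5 : (1 : ℝ≥0∞) ≤ ENNReal.ofReal (1 / 8) + P i {X | specNorm (S i - T X) < r} :=
      tsub_le_iff_right.1 h3.le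
    have h6 : (1 : ℝ≥0∞) = ENNReal.ofReal (1 / 8) + ENNReal.ofReal (7 / 8) := by
      rw [← ENNReal.ofReal_add (by norm_num) (by norm_num)]; norm_num
    rw [h6] at h5
    exact (ENNReal.add_le_add_iff_left ENNReal.ofReal_ne_top).1 h5
  have hchi : ∀ i, ChiBound (ENNReal.ofReal (Real.exp (p / 16))) (P i)
      (Measure.pi fun _ : Fin n =>
        multivariateGaussian 0 (m • (1 : Matrix (Fin p) (Fin p) ℝ))) := fun i =>
    (chiBound_gaussian_spike hm (by rw [hsq]; exact hτ) (norm_signVec hp i.2) n).mono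
      (ENNReal.ofReal_le_ofReal (Real.exp_le_exp.2 (by rw [hsq]; exact hn)))
  -- Hypotheses accepted together with `(σ, w)` are within `3/4 m τ` of it. Opposite signs are at
  -- distance at least `m τ`, and equal signs with correlation at most `1/2` at distance at least
  -- `3/4 m τ`; so only the same sign and strong correlation remain.
  have hcount : ∀ X, ∃ w : Fin p → Bool, {i | specNorm (S i - T X) < r}.ncard ≤
      {b : Fin p → Bool | (p : ℝ) / 2 < |∑ i, boolSign (b i) * boolSign (w i)|}.ncard := by
    intro X
    rcases Set.eq_empty_or_nonempty {i | specNorm (S i - T X) < r} with h | ⟨⟨σ, w⟩, hw⟩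
    · exact ⟨fun _ => true, by simp [h]⟩
    refine ⟨w, ?_⟩
    have hp0 : (0 : ℝ) < p := by positivity
    have hsub : ∀ i ∈ {i | specNorm (S i - T X) < r}, i.1 = σ ∧
        (p : ℝ) / 2 < |∑ j, boolSign (i.2 j) * boolSign (w j)| := by
      rintro ⟨σ', b⟩ hb
      simp only [Set.mem_ofPred_eq] at hb hw
      have hd := specNorm_sub_le (S (σ', b)) (S (σ, w)) (T X)
      have hl := abs_le_specNorm_spike_sub (m := m) (t := boolSign σ' * τ) (s := boolSign σ * τ)
        (w := signVec w) (norm_signVec hp b)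
      rw [real_inner_comm] at hl
      have hlt := lt_of_le_of_lt (hl.trans hd) (lt_of_lt_of_le (add_lt_add hb hw)
        (by linarith : r + r ≤ 3 / 4 * (m * τ)))
      have hx := sq_nonneg ⟪signVec b, signVec w⟫
      by_cases hσ : σ' = σ
      · refine ⟨hσ, ?_⟩
        subst hσ
        by_contra! hle
        have hin : |⟪signVec b, signVec w⟫| ≤ 1 / 2 := by
          rw [inner_signVec, abs_div, abs_of_pos hp0, div_le_iff₀ hp0]
          linarith
        have hin2 : ⟪signVec b, signVec w⟫ ^ 2 ≤ 1 / 4 := by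
          rw [← sq_abs]; nlinarith [abs_nonneg ⟪signVec b, signVec w⟫]
        have habs : |m * (boolSign σ' * τ - boolSign σ' * τ * ⟪signVec b, signVec w⟫ ^ 2)| =
            m * τ * (1 - ⟪signVec b, signVec w⟫ ^ 2) := by
          rw [show m * (boolSign σ' * τ - boolSign σ' * τ * ⟪signVec b, signVec w⟫ ^ 2) =
            boolSign σ' * (m * τ * (1 - ⟪signVec b, signVec w⟫ ^ 2)) by ring, abs_mul,
            abs_of_nonneg (mul_nonneg hmt (by linarith))]
          cases σ' <;> simp [boolSign]
        rw [habs] at hlt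
        nlinarith
      · exfalso
        have hneg : boolSign σ = -boolSign σ' := by
          cases σ <;> cases σ' <;> simp_all [boolSign]
        have habs : |m * (boolSign σ' * τ - boolSign σ * τ * ⟪signVec b, signVec w⟫ ^ 2)| =
            m * τ * (1 + ⟪signVec b, signVec w⟫ ^ 2) := by
          rw [hneg, show m * (boolSign σ' * τ - -boolSign σ' * τ *
            ⟪signVec b, signVec w⟫ ^ 2) =
            boolSign σ' * (m * τ * (1 + ⟪signVec b, signVec w⟫ ^ 2)) by ring, abs_mul,
            abs_of_nonneg (mul_nonneg hmt (by linarith))]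
          cases σ' <;> simp [boolSign]
        rw [habs] at hlt
        nlinarith
    refine Set.ncard_le_ncard_of_injOn Prod.snd (fun i hi => (hsub i hi).2) ?_ (Set.toFinite _)
    intro i hi j hj hij
    exact Prod.ext ((hsub i hi).1.trans (hsub j hj).1.symm) hij
  set M : ℕ := Finset.univ.sup fun w : Fin p → Bool =>
    {b : Fin p → Bool | (p : ℝ) / 2 < |∑ i, boolSign (b i) * boolSign (w i)|}.ncard
  obtain ⟨w, -, hw⟩ := Finset.exists_mem_eq_sup Finset.univ Finset.univ_nonempty
    fun w : Fin p → Bool =>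
      {b : Fin p → Bool | (p : ℝ) / 2 < |∑ i, boolSign (b i) * boolSign (w i)|}.ncard
  have hmain := card_mul_sq_le_of_chiBound hchi hmeas (M := M) (fun X => by
    obtain ⟨w', hw'⟩ := hcount X
    exact hw'.trans (Finset.le_sup (f := fun w : Fin p → Bool =>
      {b : Fin p → Bool | (p : ℝ) / 2 < |∑ i, boolSign (b i) * boolSign (w i)|}.ncard)
      (Finset.mem_univ w'))) hB
  have hM1 : (M : ℝ) ≤ 2 * 2 ^ p * Real.exp (-(p / 8)) := by
    change M = _ at hw
    rw [hw]; exact card_correlated_le w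
  have hM2 : (M : ℝ) ≤ 2 ^ p := by
    change M = _ at hw
    rw [hw]
    have := Set.ncard_le_card {b : Fin p → Bool |
      (p : ℝ) / 2 < |∑ i, boolSign (b i) * boolSign (w i)|}
    rw [Nat.card_eq_fintype_card, Fintype.card_fun, Fintype.card_bool, Fintype.card_fin] at this
    exact_mod_cast this
  have hreal : (2 * 2 ^ p : ℝ) * (7 / 8) ^ 2 ≤ Real.exp (p / 16) * M := by
    rw [Fintype.card_prod, Fintype.card_fun, Fintype.card_bool, Fintype.card_fin] at hmain
    have := ENNReal.toReal_mono (by finiteness) hmain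
    simpa [ENNReal.toReal_ofReal (Real.exp_pos _).le,
      ENNReal.toReal_ofReal (show (0 : ℝ) ≤ 7 / 8 by norm_num)] using this
  have hE := Real.exp_pos ((p : ℝ) / 16)
  have h2p : (0 : ℝ) < 2 ^ p := by positivity
  have hmul : Real.exp ((p : ℝ) / 16) * Real.exp ((p : ℝ) / 16) * Real.exp (-(p / 8)) = 1 := by
    rw [← Real.exp_add, ← Real.exp_add, Real.exp_eq_one_iff]; ring
  -- With `E = exp (p/16)`, the trivial count `M ≤ 2 ^ p` forces `E ≥ 49/32`, while the Chernoff
  -- count forces `E ≤ 64/49`. These are incompatible, so every `p` is covered without a separate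
  -- small case.
  have hA : (49 / 32 : ℝ) ≤ Real.exp (p / 16) := by
    refine le_of_mul_le_mul_right ?_ h2p
    nlinarith [mul_le_mul_of_nonneg_left hM2 hE.le]
  have hB' : (49 / 64 : ℝ) * Real.exp (p / 16) ≤ 1 := by
    refine le_of_mul_le_mul_left ?_ (mul_pos two_pos h2p)
    calc 2 * 2 ^ p * ((49 / 64 : ℝ) * Real.exp (p / 16))
        = ((2 * 2 ^ p : ℝ) * (7 / 8) ^ 2) * Real.exp (p / 16) := by ring
      _ ≤ (Real.exp (p / 16) * M) * Real.exp (p / 16) := by gcongr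
      _ ≤ (Real.exp (p / 16) * (2 * 2 ^ p * Real.exp (-(p / 8)))) * Real.exp (p / 16) := by
        gcongr
      _ = 2 * 2 ^ p * (Real.exp ((p : ℝ) / 16) * Real.exp ((p : ℝ) / 16) *
          Real.exp (-(p / 8))) := by ring
      _ = _ := by rw [hmul]
  linarith

/-- Starting from `M₂ I` leaves room below: the shrunken eigenvalue `M₂ (1 - a)²` is at least `M₂ -
2 a M₂ ≥ M₁`. -/
lemma half_le_minimaxProb_of_contamination {n : ℕ} {M₁ M₂ ε r a : ℝ} (hp : 1 ≤ p) (hM₁ : 0 ≤ M₁)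
    (hM : M₁ < M₂) (ha : 0 ≤ a) (ha1 : a ≤ (M₂ - M₁) / (2 * M₂))
    (hε : ENNReal.ofReal a * ∫⁻ x, ‖x‖ₑ ∂(gaussianReal 0 M₂.toNNReal) ≤ ENNReal.ofReal ε)
    (hr : 2 * r ≤ M₂ * a) :
    2⁻¹ ≤ minimaxProb n p M₁ M₂ ε r := by
  have hM₂ : 0 < M₂ := by linarith
  have ha2 : a * (2 * M₂) ≤ M₂ - M₁ := (le_div_iff₀ (by positivity)).1 ha1
  have ha3 : a ≤ 1 := by nlinarith
  have hsq := sq_nonneg (a - 1)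
  obtain ⟨v, hv⟩ : ∃ v : EuclideanSpace ℝ (Fin p), ‖v‖ = 1 :=
    ⟨signVec fun _ => true, norm_signVec hp _⟩
  refine half_le_minimaxProb (S := spike M₂ 0 v) (S' := spike M₂ (-(2 * a - a ^ 2)) v)
    (spike_mem_covClass hM₂.le (by norm_num) hM.le le_rfl (by linarith) (by linarith) hv)
    (spike_mem_covClass hM₂.le (by linarith) hM.le le_rfl ?_ ?_ hv)
    (gaussian_mem_contaminated _ _) ⟨inferInstance, (W1_spike_le hM₂.le ha hv).trans hε⟩ ?_
  · nlinarith [mul_nonneg hM₂.le (sq_nonneg a)]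
  · nlinarith [mul_nonneg hM₂.le (mul_nonneg ha (by linarith : 0 ≤ 2 - a))]
  · refine le_trans ?_ (abs_le_specNorm_spike_sub hv)
    rw [real_inner_self_eq_norm_sq, hv]
    refine le_trans ?_ (le_abs_self _)
    nlinarith [mul_nonneg hM₂.le (mul_nonneg ha (by linarith : 0 ≤ 1 - a))]

end

end RobustCov

/-! ### Choice of constants and the two regimes. -/

theorem theorem10 :
    ∃ c : ℝ, 0 < c ∧
      ∀ M₁ M₂ K : ℝ, 0 ≤ M₁ → M₁ < M₂ →
        ∃ C : ℝ, 0 < C ∧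
          ∀ (n p : ℕ) (ε : ℝ), 1 ≤ n → 1 ≤ p → 0 ≤ ε → (p : ℝ) / n + ε ^ 2 ≤ K →
            ENNReal.ofReal c ≤
              RobustCov.minimaxProb n p M₁ M₂ ε (C * max (Real.sqrt ((p : ℝ) / n)) ε) := by
  refine ⟨1 / 8, by norm_num, fun M₁ M₂ K hM₁ hM => ?_⟩
  have hM₂ : 0 < M₂ := by linarith
  obtain ⟨B, hB⟩ : ∃ B : NNReal, ∫⁻ x, ‖x‖ₑ ∂(gaussianReal 0 M₂.toNNReal) = B := by
    have h := (memLp_id_gaussianReal (μ := 0) (v := M₂.toNNReal) 1).integrable le_rfl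
    exact ⟨_, (ENNReal.coe_toNNReal h.2.ne).symm⟩
  set q : ℝ := (M₂ - M₁) / (2 * M₂) with hq
  have hq0 : 0 < q := div_pos (by linarith) (by linarith)
  have hqM : q * (2 * M₂) = M₂ - M₁ := div_mul_cancel₀ _ (by positivity)
  have hq1 : q ≤ 1 / 2 := by nlinarith
  set L : ℝ := √K + 1 with hL
  have hL0 : 0 < L := by positivity
  -- Here `1/4` yields `n τ² ≤ p/16` for `τ = κ s`; in `α`, `1/(B + 1)` keeps the transport cost
  -- below `ε`. The terms `q / L` keep the spectra in `[M₁, M₂]`, since `L` bounds both `s` and `ε`.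
  set κ : ℝ := min (1 / 4) (q / L) with hκ
  set α : ℝ := min (1 / (B + 1)) (q / L) with hα
  have hκ0 : 0 < κ := lt_min (by norm_num) (by positivity)
  have hα0 : 0 < α := lt_min (by positivity) (by positivity)
  have hκL : κ * L ≤ q := (le_div_iff₀ hL0).1 (min_le_right _ _)
  have hαL : α * L ≤ q := (le_div_iff₀ hL0).1 (min_le_right _ _)
  have hκ4 : κ ≤ 1 / 4 := min_le_left _ _
  have hαB : α * (B + 1) ≤ 1 := (le_div_iff₀ (by positivity)).1 (min_le_left _ _)
  -- The midpoint leaves equal room for spikes of both signs.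
  set m : ℝ := (M₁ + M₂) / 2 with hm
  have hm0 : 0 < m := by rw [hm]; linarith
  have hmM : m ≤ M₂ := by rw [hm]; linarith
  refine ⟨min (3 / 8 * (m * κ)) (M₂ * α / 2), lt_min (by positivity) (by positivity),
    fun n p ε hn hp hε hK => ?_⟩
  have hn0 : (0 : ℝ) < n := by exact_mod_cast hn
  have hp0 : (0 : ℝ) < p := by exact_mod_cast hp
  have hpn : 0 < (p : ℝ) / n := by positivity
  set s : ℝ := √((p : ℝ) / n) with hs
  have hs0 : 0 < s := Real.sqrt_pos.2 hpn
  have hs2 : s ^ 2 = p / n := Real.sq_sqrt hpn.le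
  have hsL : s ≤ L := by
    have : s ≤ √K := Real.sqrt_le_sqrt (by nlinarith)
    linarith
  have hεL : ε ≤ L := by
    have : ε ≤ √K := Real.le_sqrt_of_sq_le (by linarith)
    linarith
  rcases le_total ε s with h | h
  · rw [max_eq_left h]
    have hτq : κ * s ≤ q := (mul_le_mul_of_nonneg_left hsL hκ0.le).trans hκL
    have hmq : m * (κ * s) ≤ (M₂ - M₁) / 2 := by
      calc m * (κ * s) ≤ M₂ * q := by gcongr
        _ = _ := by linarith
    refine RobustCov.eighth_le_minimaxProb (m := m) (τ := κ * s) hp hm0.le (by positivity) ?_ ?_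
      ?_ ?_ ?_
    · nlinarith [mul_pos hκ0 hs0]
    · rw [mul_pow, hs2]
      calc (n : ℝ) * (κ ^ 2 * (p / n)) = κ ^ 2 * (p : ℝ) := by field_simp
        _ ≤ (1 / 4) ^ 2 * (p : ℝ) := by gcongr
        _ = (p : ℝ) / 16 := by ring
    · rw [mul_sub, mul_one]
      linarith
    · rw [mul_add, mul_one]
      linarith
    · have := mul_le_mul_of_nonneg_right (min_le_left (3 / 8 * (m * κ)) (M₂ * α / 2)) hs0.le
      linarith
  · rw [max_eq_right h]
    refine le_trans ?_ (RobustCov.half_le_minimaxProb_of_contamination (a := α * ε) hp hM₁ hM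
      (by positivity) ((mul_le_mul_of_nonneg_left hεL hα0.le).trans hαL) ?_ ?_)
    · rw [← ENNReal.ofReal_ofNat, ← ENNReal.ofReal_inv_of_pos two_pos]
      exact ENNReal.ofReal_le_ofReal (by norm_num)
    · rw [hB, ← ENNReal.ofReal_coe_nnreal, ← ENNReal.ofReal_mul (by positivity)]
      refine ENNReal.ofReal_le_ofReal ?_
      nlinarith [mul_le_mul_of_nonneg_left hαB hε, mul_nonneg hα0.le hε]
    · have := mul_le_mul_of_nonneg_right (min_le_right (3 / 8 * (m * κ)) (M₂ * α / 2)) hε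
      linarith
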